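/- Let $X_1,X_2,\dots$ be independent real random variables on a probability space, all with the same nondegenerate Gaussian law $G=\mathcal N(m,\sigma^2)$, $m\in\mathbb R$, $\sigma>0$. For $n\ge1$, $\ell\ge 1$ and $p\ge2$ put $\overline X=\frac1n\sum_{i=1}^nX_i$, $$\mu_{n,\ell}=\frac1n\sum_{i=1}^n(X_i-\overline X)^\ell,\qquad b_{n,p}=\frac{\mu_{n,2p-1}}{\mu_{n,2}^{(2p-1)/2}},\qquad a_{n,p}=\frac{\mu_{n,2p}}{\mu_{n,2}^{p}}.$$ Then, as $n\to\infty$, $$\frac n6\Big(b_{n,2}^2+\frac{(a_{n,2}-3)^2}{4}\Big)\ \longrightarrow\ \chi^2_2\quad\text{in law.}$$ Moreover, this statistic is the case $p=2$ of the statistic $n\big(b_{n,p}^2/bj(p)+(a_{n,p}-a_p)^2/aj(p)\big)$ for symmetric laws with finite $4p$-th moment, in the following sense. Let $m_\ell=\int x^\ell\,dG(x)$ (so $m_1=m$), $\mu_\ell=\int (x-m)^\ell\,dG(x)$, $b_p=\mu_{2p-1}/\sigma^{2p-1}$, $a_p=\mu_{2p}/\sigma^{2p}$, $h_\ell(x)=x^\ell$,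 and $$A(\ell)=h_\ell+\sum_{q=0}^{\ell-1}\binom{\ell}{q}(-1)^{\ell-q}\big(m^{\ell-q}h_q+(\ell-q)m^{\ell-q-1}m_q h_1\big),$$ $$B(p)=\sigma^{-(2p-1)}\Big(A(2p-1)-\tfrac{2p-1}{2}\sigma^{-2}\mu_{2p-1}A(2)\Big),\qquad C(p)=\sigma^{-2p}\big(A(2p)-p\,\sigma^{-2}\mu_{2p}A(2)\big),$$ and let $bj(p)=\operatorname{Var}_G(B(p))$ and $aj(p)=\operatorname{Var}_G(C(p))$ be the variances of these functions under $G$. Then $G$ is symmetric about $m$ with $\int x^{8}\,dG(x)<\infty$, $b_2=0$, $a_2=3$, $bj(2)=6$, $aj(2)=24$, and consequently, for every $n$, $$n\Big(\frac{b_{n,2}^2}{bj(2)}+\frac{(a_{n,2}-a_2)^2}{aj(2)}\Big)=\frac n6\Big(b_{n,2}^2+\frac{(a_{n,2}-3)^2}{4}\Big).$$ -/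

import Mathlib

open MeasureTheory ProbabilityTheory Filter

noncomputable section

namespace JarqueBera

/-! ### Empirical quantities of a sample `x 0, …, x (n - 1)` -/

/-- Sample mean. -/
def sampleMean (x : ℕ → ℝ) (n : ℕ) : ℝ :=
  (1 / (n : ℝ)) * ∑ i ∈ Finset.range n, x i

/-- Centered empirical moment of order `l`. -/
def sampleCentralMoment (x : ℕ → ℝ) (n l : ℕ) : ℝ :=
  (1 / (n : ℝ)) * ∑ i ∈ Finset.range n, (x i - sampleMean x n) ^ l

/-- Normalized centered empirical moment of odd order `2p - 1`
(for `p = 2`, the sample skewness). -/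
def bStat (x : ℕ → ℝ) (n p : ℕ) : ℝ :=
  sampleCentralMoment x n (2 * p - 1) /
    sampleCentralMoment x n 2 ^ ((2 * (p : ℝ) - 1) / 2)

/-- Normalized centered empirical moment of even order `2p`
(for `p = 2`, the sample kurtosis). -/
def aStat (x : ℕ → ℝ) (n p : ℕ) : ℝ :=
  sampleCentralMoment x n (2 * p) / sampleCentralMoment x n 2 ^ p

/-- The classical Jarque–Bera statistic. -/
def jbStat (x : ℕ → ℝ) (n : ℕ) : ℝ :=
  (n : ℝ) / 6 * (bStat x n 2 ^ 2 + (aStat x n 2 - 3) ^ 2 / 4)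

/-! ### Theoretical quantities of a law `G` on the real line -/

/-- Standard deviation of `G`. -/
def sd (G : Measure ℝ) : ℝ := √(variance id G)

/-- Theoretical value of `bStat`. -/
def bCoef (G : Measure ℝ) (p : ℕ) : ℝ :=
  centralMoment id (2 * p - 1) G / sd G ^ (2 * p - 1)

/-- Theoretical value of `aStat`. -/
def aCoef (G : Measure ℝ) (p : ℕ) : ℝ :=
  centralMoment id (2 * p) G / sd G ^ (2 * p)

/-- The function `A(l)` that linearizes the `l`-th centered empirical moment. -/
def linA (G : Measure ℝ) (l : ℕ) (x : ℝ) : ℝ :=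
  x ^ l + ∑ p ∈ Finset.range l, (l.choose p : ℝ) * (-1) ^ (l - p) *
    (moment id 1 G ^ (l - p) * x ^ p
      + ((l - p : ℕ) : ℝ) * moment id 1 G ^ (l - p - 1) * moment id p G * x)

/-- The function `B(p)` that linearizes `bStat`. -/
def linB (G : Measure ℝ) (p : ℕ) (x : ℝ) : ℝ :=
  (sd G ^ (2 * p - 1))⁻¹ *
    (linA G (2 * p - 1) x
      - 1 / 2 * (2 * (p : ℝ) - 1) * (sd G ^ 2)⁻¹ * centralMoment id (2 * p - 1) G * linA G 2 x)

/-- The function `C(p)` that linearizes `aStat`. -/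
def linC (G : Measure ℝ) (p : ℕ) (x : ℝ) : ℝ :=
  (sd G ^ (2 * p))⁻¹ *
    (linA G (2 * p) x
      - (p : ℝ) * (sd G ^ 2)⁻¹ * centralMoment id (2 * p) G * linA G 2 x)

/-- `bj(p)`, the variance of `B(p)` under `G`. -/
def bj (G : Measure ℝ) (p : ℕ) : ℝ := variance (linB G p) G

/-- `aj(p)`, the variance of `C(p)` under `G`. -/
def aj (G : Measure ℝ) (p : ℕ) : ℝ := variance (linC G p) G

/-- The general test statistic of order `p` for a symmetric law `G`. -/
def symStat (G : Measure ℝ) (x : ℕ → ℝ) (n p : ℕ) : ℝ :=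
  (n : ℝ) * (bStat x n p ^ 2 / bj G p + (aStat x n p - aCoef G p) ^ 2 / aj G p)

/-- `G` is symmetric about the point `m`. -/
def IsSymmetricAbout (G : Measure ℝ) (m : ℝ) : Prop :=
  G.map (fun x => 2 * m - x) = G

/-! ### The chi-square law -/

/-- The chi-square law with `k` degrees of freedom: the law of the sum of the squares of `k`
independent standard normal random variables. -/
def chiSquare (k : ℕ) : Measure ℝ :=
  (Measure.pi fun _ : Fin k => gaussianReal 0 1).map fun z => ∑ i, z i ^ 2

instance instIsProbabilityMeasureChiSquare (k : ℕ) : IsProbabilityMeasure (chiSquare k) :=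
  Measure.isProbabilityMeasure_map (by
    have h : Measurable fun z : Fin k → ℝ => ∑ i, z i ^ 2 := by fun_prop
    exact h.aemeasurable)

end JarqueBera

end

namespace JarqueBera

/-! ### Polynomials under the standard normal law -/

/-! The statistic is unchanged by `x ↦ m + c * x` with `c ≠ 0` (`jbStat_affine`), so the sample may
be taken standard normal. Let `Hₗ` be the empirical mean of the `l`-th Hermite polynomial. Then the
third central moment is `H₃`, and the fourth minus three times the squared second is `H₄`, up to
products of at least two Hermite means.

The Hermite polynomials are orthogonal with squared norm `l!`, so by the central limit theorem `√n
H₃ / √6` and `√n H₄ / √24` tend jointly to independent standard normals. In each product one factor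
absorbs `√n` and the others vanish almost surely by the strong law, while the sample variance tends
to 1. Slutsky's theorem applied to the polynomial `jbPoly` then leaves the sum of the squares of
those two normals.

The constants 6 and 24 are `3!` and `4!`: in the standardized variable, `B(2)` and `C(2)` are the
third and fourth Hermite polynomials up to additive constants. -/

open Polynomial in
lemma integrable_eval_gaussianReal (m : ℝ) (v : NNReal) (p : ℝ[X]) :
    Integrable (fun x => p.eval x) (gaussianReal m v) := by
  have hpow (k : ℕ) : Integrable (fun x : ℝ => x ^ k) (gaussianReal m v) := by
    have h := (memLp_id_gaussianReal (μ := m) (v := v) k).integrable_norm_pow'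
    simp only [id, ← norm_pow] at h
    exact (integrable_norm_iff (by fun_prop)).1 h
  induction p using Polynomial.induction_on' with
  | add p q hp hq =>
    simp only [eval_add]
    exact hp.add hq
  | monomial n a => simpa only [eval_monomial] using (hpow n).const_mul a

lemma hasDerivAt_gaussianPDFReal_zero_one (x : ℝ) :
    HasDerivAt (gaussianPDFReal 0 1) (-(x * gaussianPDFReal 0 1 x)) x := by
  have h : HasDerivAt (fun y : ℝ => -(y - 0) ^ 2 / (2 * ((1 : NNReal) : ℝ))) (-x) x := by
    have := (((hasDerivAt_id x).sub_const 0).pow 2).neg.div_const (2 * ((1 : NNReal) : ℝ))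
    refine this.congr_deriv ?_
    simp
    ring
  rw [gaussianPDFReal_def]
  refine (h.exp.const_mul (√(2 * Real.pi * ((1 : NNReal) : ℝ)))⁻¹).congr_deriv ?_
  ring

open Polynomial in
/-- Stein's identity for polynomials. -/
lemma integral_id_mul_eval_gaussianReal (p : ℝ[X]) :
    ∫ x, x * p.eval x ∂gaussianReal 0 1 = ∫ x, (derivative p).eval x ∂gaussianReal 0 1 := by
  have hint (q : ℝ[X]) : Integrable fun x => q.eval x * gaussianPDFReal 0 1 x := by
    have h := integrable_eval_gaussianReal 0 1 q
    rw [gaussianReal_of_var_ne_zero _ one_ne_zero,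
      integrable_withDensity_iff (measurable_gaussianPDF _ _)
        (ae_of_all _ fun _ => gaussianPDF_lt_top)] at h
    simpa using h
  have key := integral_mul_deriv_eq_deriv_mul_of_integrable (u := fun x => p.eval x)
    (v := gaussianPDFReal 0 1) (u' := fun x => (derivative p).eval x)
    (v' := fun x => -(x * gaussianPDFReal 0 1 x)) (fun x _ => p.hasDerivAt x)
    (fun x _ => hasDerivAt_gaussianPDFReal_zero_one x)
    (by
      refine (hint (X * p)).neg.congr (ae_of_all _ fun x => ?_)
      simp
      ring)
    (hint _) (hint _)
  rw [integral_gaussianReal_eq_integral_smul one_ne_zero,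
    integral_gaussianReal_eq_integral_smul one_ne_zero]
  simp only [smul_eq_mul]
  rw [← neg_inj, ← integral_neg]
  simp only [mul_comm (gaussianPDFReal 0 1 _)]
  rw [← key]
  congr 1 with x
  ring

/-- The `n`-th (probabilists') Hermite polynomial as a real function. -/
noncomputable def hermiteFun (n : ℕ) (x : ℝ) : ℝ :=
  ((Polynomial.hermite n).map (Int.castRingHom ℝ)).eval x

@[fun_prop]
lemma continuous_hermiteFun (n : ℕ) : Continuous (hermiteFun n) :=
  Polynomial.continuous _

@[fun_prop]
lemma measurable_hermiteFun (n : ℕ) : Measurable (hermiteFun n) :=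
  (continuous_hermiteFun n).measurable

lemma hermiteFun_zero (x : ℝ) : hermiteFun 0 x = 1 := by simp [hermiteFun]

lemma hermiteFun_one (x : ℝ) : hermiteFun 1 x = x := by simp [hermiteFun]

lemma hermiteFun_two (x : ℝ) : hermiteFun 2 x = x ^ 2 - 1 := by
  simp [hermiteFun, Polynomial.hermite_succ]
  ring

lemma hermiteFun_three (x : ℝ) : hermiteFun 3 x = x ^ 3 - 3 * x := by
  simp [hermiteFun, Polynomial.hermite_succ]
  ring

lemma hermiteFun_four (x : ℝ) : hermiteFun 4 x = x ^ 4 - 6 * x ^ 2 + 3 := by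
  simp [hermiteFun, Polynomial.hermite_succ]
  ring

lemma integrable_hermiteFun_mul (n k : ℕ) :
    Integrable (fun x => hermiteFun n x * hermiteFun k x) (gaussianReal 0 1) := by
  simpa only [Polynomial.eval_mul, hermiteFun] using integrable_eval_gaussianReal 0 1
    ((Polynomial.hermite n).map (Int.castRingHom ℝ) *
      (Polynomial.hermite k).map (Int.castRingHom ℝ))

lemma memLp_hermiteFun (n : ℕ) : MemLp (hermiteFun n) 2 (gaussianReal 0 1) := by
  rw [memLp_two_iff_integrable_sq (by fun_prop)]
  simpa only [sq] using integrable_hermiteFun_mul n n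

open Polynomial in
-- Repeated Gaussian integration by parts: since `He_{n+1} = x He_n - He_n'`, Stein's identity moves
-- one derivative onto `q` at each step.
lemma integral_hermiteFun_mul_eval (n : ℕ) (q : ℝ[X]) :
    ∫ x, hermiteFun n x * q.eval x ∂gaussianReal 0 1 =
      ∫ x, (derivative^[n] q).eval x ∂gaussianReal 0 1 := by
  induction n generalizing q with
  | zero => simp [hermiteFun]
  | succ n ih =>
    set h := (hermite n).map (Int.castRingHom ℝ) with hh
    have h1 : ∀ x, hermiteFun (n + 1) x * q.eval x =
        x * (h * q).eval x - (derivative h * q).eval x := fun x => by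
      simp [hermiteFun, hermite_succ, derivative_map, hh]
      ring
    have hX : Integrable (fun x => x * (h * q).eval x) (gaussianReal 0 1) := by
      refine (integrable_eval_gaussianReal 0 1 (X * (h * q))).congr (ae_of_all _ fun x => ?_)
      simp only [eval_mul, eval_X]
    simp only [h1]
    rw [integral_sub hX (integrable_eval_gaussianReal _ _ _), integral_id_mul_eval_gaussianReal,
      ← integral_sub (integrable_eval_gaussianReal _ _ _) (integrable_eval_gaussianReal _ _ _),
      Function.iterate_succ_apply, ← ih]
    congr 1 with x
    simp [hermiteFun, hh]

/-- The Hermite polynomials are orthogonal for the standard normal law. -/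
lemma integral_hermiteFun_mul_hermiteFun (n k : ℕ) :
    ∫ x, hermiteFun n x * hermiteFun k x ∂gaussianReal 0 1 =
      if n = k then (n.factorial : ℝ) else 0 := by
  have hlt {n k : ℕ} (h : k < n) :
      ∫ x, hermiteFun n x * hermiteFun k x ∂gaussianReal 0 1 = 0 := by
    simp only [hermiteFun.eq_1 k]
    rw [integral_hermiteFun_mul_eval, Polynomial.iterate_derivative_eq_zero]
    · simp
    · exact (Polynomial.natDegree_map_le).trans_lt (by simpa using h)
  rcases lt_trichotomy n k with h | rfl | h
  · simp only [mul_comm (hermiteFun n _)]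
    rw [hlt h, if_neg h.ne]
  -- `He_n` is monic of degree `n`, so only its leading term survives `n` derivatives.
  · have hc : (Polynomial.derivative^[n] (Polynomial.hermite n)) =
        Polynomial.C (n.factorial : ℤ) := by
      ext j
      rw [Polynomial.coeff_iterate_derivative, Polynomial.coeff_C]
      rcases j with _ | j
      · simp [Nat.descFactorial_self]
      · rw [Polynomial.coeff_hermite_of_lt (by omega)]
        simp
    simp only [hermiteFun.eq_1 n]
    rw [← funext fun x => congrArg (· * _) (hermiteFun.eq_1 n x), integral_hermiteFun_mul_eval,
      Polynomial.iterate_derivative_map, hc]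
    simp
  · rw [hlt h, if_neg h.ne']

lemma integral_hermiteFun (n : ℕ) :
    ∫ x, hermiteFun n x ∂gaussianReal 0 1 = if n = 0 then 1 else 0 := by
  have := integral_hermiteFun_mul_hermiteFun n 0
  simp only [hermiteFun_zero, mul_one] at this
  rw [this]
  split_ifs with h <;> simp [h]

lemma integrable_hermiteFun (n : ℕ) : Integrable (hermiteFun n) (gaussianReal 0 1) :=
  (memLp_hermiteFun n).integrable (by norm_num)

lemma variance_hermiteFun {n : ℕ} (hn : n ≠ 0) :
    variance (hermiteFun n) (gaussianReal 0 1) = n.factorial := by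
  rw [variance_of_integral_eq_zero (by fun_prop) (by rw [integral_hermiteFun, if_neg hn])]
  simpa [sq] using integral_hermiteFun_mul_hermiteFun n n

/-! ### Central limit theorem in a Euclidean space -/

open scoped RealInnerProductSpace Topology

section CentralLimit

variable {Ω Ω' E : Type*} [MeasurableSpace Ω] [MeasurableSpace Ω'] {P : Measure Ω}
  {P' : Measure Ω'}

/-- The Cramér–Wold device, which reduces the vector limit theorem to real projections. -/
lemma charFun_map_eq_charFun_map_inner [NormedAddCommGroup E] [InnerProductSpace ℝ E]
    [MeasurableSpace E] [BorelSpace E] [SecondCountableTopology E]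
    {Z : Ω → E} (hZ : AEMeasurable Z P) (t : E) :
    charFun (P.map Z) t = charFun (P.map fun ω => ⟪Z ω, t⟫) 1 := by
  rw [charFun_apply, charFun_apply_real, integral_map hZ (by fun_prop),
    integral_map (by fun_prop) (by fun_prop)]
  simp

variable [IsProbabilityMeasure P] [IsProbabilityMeasure P']

/-- **Central limit theorem** for isotropic random vectors: i.i.d. centered square-integrable
vectors with identity covariance. -/
theorem tendstoInDistribution_inv_sqrt_smul_sum [NormedAddCommGroup E] [InnerProductSpace ℝ E]
    [FiniteDimensional ℝ E] [MeasurableSpace E] [BorelSpace E] {ξ : ℕ → Ω → E} {Y : Ω' → E}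
    (hY : HasLaw Y (stdGaussian E) P') (hindep : iIndepFun ξ P)
    (hident : ∀ i, IdentDistrib (ξ i) (ξ 0) P P) (hL2 : MemLp (ξ 0) 2 P)
    (hmean : ∀ t, ∫ ω, ⟪ξ 0 ω, t⟫ ∂P = 0) (hcov : ∀ t, ∫ ω, ⟪ξ 0 ω, t⟫ ^ 2 ∂P = ‖t‖ ^ 2) :
    TendstoInDistribution (fun (n : ℕ) ω => (√(n : ℝ))⁻¹ • ∑ k ∈ Finset.range n, ξ k ω) atTop Y
      (fun _ => P) P' := by
  have hξ (i : ℕ) : AEMeasurable (ξ i) P := (hident i).aemeasurable_fst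
  have hW (n : ℕ) : AEMeasurable (fun ω => (√(n : ℝ))⁻¹ • ∑ k ∈ Finset.range n, ξ k ω) P :=
    (Finset.aemeasurable_fun_sum _ fun _ _ => hξ _).const_smul _
  refine ⟨hW, hY.aemeasurable, ProbabilityMeasure.tendsto_iff_tendsto_charFun.2 fun t => ?_⟩
  have hvar : variance (fun ω => ⟪ξ 0 ω, t⟫) P = ‖t‖ ^ 2 := by
    rw [variance_of_integral_eq_zero ((hξ 0).inner_const) (hmean t), hcov]
  -- The projection on `t` has mean 0 and variance `‖t‖ ^ 2`; its limiting characteristic function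
  -- at 1 is that of `stdGaussian E` at `t`.
  have hclt := tendstoInDistribution_inv_sqrt_mul_sum_sub (P := P)
    (X := fun k ω => ⟪ξ k ω, t⟫) (Y := id)
    (P' := gaussianReal 0 (variance (fun ω => ⟪ξ 0 ω, t⟫) P).toNNReal)
    HasLaw.id (hL2.inner_const t) (hindep.comp (fun _ x => ⟪x, t⟫) fun _ => by fun_prop)
    (fun i => (hident i).comp (u := fun x => ⟪x, t⟫) (by fun_prop))
  have h1 := ProbabilityMeasure.tendsto_iff_tendsto_charFun.1 hclt.tendsto 1
  simp only [ProbabilityMeasure.coe_mk, Measure.map_id, charFun_gaussianReal, hvar, hmean] at h1 ⊢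
  rw [hY.map_eq, charFun_stdGaussian]
  convert h1 using 2 with n
  · rw [charFun_map_eq_charFun_map_inner (hW n)]
    simp [inner_smul_left, sum_inner]
  · simp [Real.coe_toNNReal _ (sq_nonneg ‖t‖), neg_div]

/-- Central limit theorem for an orthonormal family of centered functions of an i.i.d. sequence. -/
theorem tendstoInDistribution_inv_sqrt_mul_sum_orthonormal {ι : Type*} [Fintype ι]
    [DecidableEq ι] {Z : ℕ → Ω → ℝ} {ν : Measure ℝ} {f : ι → ℝ → ℝ} {Y : Ω' → EuclideanSpace ℝ ι}
    (hY : HasLaw Y (stdGaussian (EuclideanSpace ℝ ι)) P') (hindep : iIndepFun Z P)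
    (hlaw : ∀ k, HasLaw (Z k) ν P) (hf : ∀ i, Measurable (f i)) (hL2 : ∀ i, MemLp (f i) 2 ν)
    (hmean : ∀ i, ∫ x, f i x ∂ν = 0)
    (hcov : ∀ i j, ∫ x, f i x * f j x ∂ν = if i = j then 1 else 0) :
    TendstoInDistribution (fun (n : ℕ) ω => WithLp.toLp 2 fun i =>
      (√(n : ℝ))⁻¹ * ∑ k ∈ Finset.range n, f i (Z k ω)) atTop Y (fun _ => P) P' := by
  have hν : IsProbabilityMeasure ν := (hlaw 0).isProbabilityMeasure_iff.1 inferInstance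
  have hint (i : ι) : Integrable (f i) ν := (hL2 i).integrable (by norm_num)
  let F : ℝ → EuclideanSpace ℝ ι := fun x => WithLp.toLp 2 fun i => f i x
  have hF : Measurable F := by fun_prop
  have hinner (x : ℝ) (t : EuclideanSpace ℝ ι) : ⟪F x, t⟫ = ∑ i, t i * f i x := by
    simp [F, PiLp.inner_apply]
  have h := tendstoInDistribution_inv_sqrt_smul_sum (P := P) (ξ := fun k ω => F (Z k ω)) hY
    (hindep.comp (fun _ => F) fun _ => hF)
    (fun i => ((hlaw i).identDistrib (hlaw 0)).comp hF) ?_ (fun t => ?_) (fun t => ?_)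
  · have hfun : (fun (n : ℕ) ω => WithLp.toLp 2 fun i =>
        (√(n : ℝ))⁻¹ * ∑ k ∈ Finset.range n, f i (Z k ω)) =
        fun (n : ℕ) ω => (√(n : ℝ))⁻¹ • ∑ k ∈ Finset.range n, F (Z k ω) := by
      ext n ω i
      simp [F]
    rwa [hfun]
  · have : MemLp F 2 ν := MemLp.of_eval_piLp fun i => hL2 i
    rw [← (hlaw 0).map_eq] at this
    exact this.comp_of_map (hlaw 0).aemeasurable
  · refine ((hlaw 0).integral_comp (f := fun x => ⟪F x, t⟫) (by fun_prop)).trans ?_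
    simp only [hinner]
    rw [integral_finsetSum _ fun i _ => (hint i).const_mul _]
    simp [integral_const_mul, hmean]
  · refine ((hlaw 0).integral_comp (f := fun x => ⟪F x, t⟫ ^ 2) (by fun_prop)).trans ?_
    simp only [hinner, sq (∑ i, _), Finset.sum_mul_sum]
    have hij (i j : ι) : Integrable (fun x => t i * f i x * (t j * f j x)) ν :=
      ((hL2 i).const_mul (t i)).integrable_mul ((hL2 j).const_mul (t j))
    rw [integral_finsetSum _ fun i _ => integrable_finsetSum _ fun j _ => hij i j]
    have hval (i j : ι) :
        ∫ x, t i * f i x * (t j * f j x) ∂ν = t i * t j * if i = j then 1 else 0 := by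
      rw [← hcov, ← integral_const_mul]
      congr 1 with x
      ring
    simp_rw [integral_finsetSum _ fun j _ => hij _ j, hval, EuclideanSpace.real_norm_sq_eq]
    simp [sq]

end CentralLimit

/-! ### Algebra of the sample statistics -/

lemma sampleMean_affine (c m : ℝ) (z : ℕ → ℝ) {n : ℕ} (hn : n ≠ 0) :
    sampleMean (fun i => m + c * z i) n = m + c * sampleMean z n := by
  simp only [sampleMean, Finset.sum_add_distrib, ← Finset.mul_sum]
  simp
  field_simp

lemma sampleCentralMoment_affine (c m : ℝ) (z : ℕ → ℝ) (n l : ℕ) :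
    sampleCentralMoment (fun i => m + c * z i) n l = c ^ l * sampleCentralMoment z n l := by
  rcases eq_or_ne n 0 with rfl | hn
  · simp [sampleCentralMoment]
  · rw [sampleCentralMoment, sampleMean_affine c m z hn, sampleCentralMoment]
    simp only [add_sub_add_left_eq_sub, ← mul_sub, mul_pow, ← Finset.mul_sum]
    ring

lemma sampleCentralMoment_two_nonneg (x : ℕ → ℝ) (n : ℕ) : 0 ≤ sampleCentralMoment x n 2 := by
  unfold sampleCentralMoment
  positivity

/-- Squaring turns the real exponent 3/2 into the integer 3, so the rest is rational algebra. -/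
lemma bStat_two_sq (x : ℕ → ℝ) (n : ℕ) :
    bStat x n 2 ^ 2 = sampleCentralMoment x n 3 ^ 2 / sampleCentralMoment x n 2 ^ 3 := by
  rw [bStat, div_pow, ← Real.rpow_natCast (_ ^ _), ← Real.rpow_mul
    (sampleCentralMoment_two_nonneg x n), ← Real.rpow_natCast _ 3]
  norm_num

lemma jbStat_eq (x : ℕ → ℝ) (n : ℕ) :
    jbStat x n = (n : ℝ) / 6 * (sampleCentralMoment x n 3 ^ 2 / sampleCentralMoment x n 2 ^ 3 +
      (sampleCentralMoment x n 4 / sampleCentralMoment x n 2 ^ 2 - 3) ^ 2 / 4) := by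
  rw [jbStat, bStat_two_sq, aStat]

lemma jbStat_affine {c : ℝ} (hc : c ≠ 0) (m : ℝ) (z : ℕ → ℝ) (n : ℕ) :
    jbStat (fun i => m + c * z i) n = jbStat z n := by
  simp only [jbStat_eq, sampleCentralMoment_affine, mul_pow, ← pow_mul]
  rw [mul_div_mul_left _ _ (by positivity), mul_div_mul_left _ _ (by positivity)]

/-- Empirical mean of the `l`-th Hermite polynomial. -/
noncomputable def hermiteMean (z : ℕ → ℝ) (n l : ℕ) : ℝ :=
  (1 / (n : ℝ)) * ∑ i ∈ Finset.range n, hermiteFun l (z i)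

lemma sampleMean_eq_hermiteMean (z : ℕ → ℝ) (n : ℕ) : sampleMean z n = hermiteMean z n 1 := by
  simp [sampleMean, hermiteMean, hermiteFun_one]

section HermiteMean

variable (z : ℕ → ℝ) {n : ℕ} (hn : n ≠ 0)
include hn

lemma sum_hermiteFun (l : ℕ) :
    ∑ i ∈ Finset.range n, hermiteFun l (z i) = n * hermiteMean z n l := by
  rw [hermiteMean]
  field_simp

lemma sampleCentralMoment_two_eq :
    sampleCentralMoment z n 2 = hermiteMean z n 2 + 1 - hermiteMean z n 1 ^ 2 := by
  have h (x a : ℝ) : (x - a) ^ 2 =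
      hermiteFun 2 x + (-2 * a) * hermiteFun 1 x + (1 + a ^ 2) := by
    rw [hermiteFun_one, hermiteFun_two]
    ring
  simp only [sampleCentralMoment, sampleMean_eq_hermiteMean, h, Finset.sum_add_distrib,
    ← Finset.mul_sum, sum_hermiteFun z hn, Finset.sum_const, Finset.card_range, nsmul_eq_mul]
  field_simp
  ring

lemma sampleCentralMoment_three_eq :
    sampleCentralMoment z n 3 = hermiteMean z n 3 - 3 * hermiteMean z n 1 * hermiteMean z n 2 +
      2 * hermiteMean z n 1 ^ 3 := by
  have h (x a : ℝ) : (x - a) ^ 3 = hermiteFun 3 x + (-3 * a) * hermiteFun 2 x +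
      (3 + 3 * a ^ 2) * hermiteFun 1 x + (-3 * a - a ^ 3) := by
    rw [hermiteFun_one, hermiteFun_two, hermiteFun_three]
    ring
  simp only [sampleCentralMoment, sampleMean_eq_hermiteMean, h, Finset.sum_add_distrib,
    ← Finset.mul_sum, sum_hermiteFun z hn, Finset.sum_const, Finset.card_range, nsmul_eq_mul]
  field_simp
  ring

/-- Subtracting `3 μ₂²` removes both the constant 3 and the linear term `6 H₂`, so `H₄` is the only
first-order term. -/
lemma sampleCentralMoment_four_sub_eq :
    sampleCentralMoment z n 4 - 3 * sampleCentralMoment z n 2 ^ 2 =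
      hermiteMean z n 4 - 3 * hermiteMean z n 2 ^ 2 - 4 * hermiteMean z n 1 * hermiteMean z n 3 +
      12 * hermiteMean z n 1 ^ 2 * hermiteMean z n 2 - 6 * hermiteMean z n 1 ^ 4 := by
  have h (x a : ℝ) : (x - a) ^ 4 = hermiteFun 4 x + (-4 * a) * hermiteFun 3 x +
      (6 + 6 * a ^ 2) * hermiteFun 2 x + (-12 * a - 4 * a ^ 3) * hermiteFun 1 x +
      (3 + 6 * a ^ 2 + a ^ 4) := by
    rw [hermiteFun_one, hermiteFun_two, hermiteFun_three, hermiteFun_four]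
    ring
  rw [sampleCentralMoment_two_eq z hn]
  simp only [sampleCentralMoment, sampleMean_eq_hermiteMean, h, Finset.sum_add_distrib,
    ← Finset.mul_sum, sum_hermiteFun z hn, Finset.sum_const, Finset.card_range, nsmul_eq_mul]
  field_simp
  ring

end HermiteMean

/-- The Jarque–Bera statistic in terms of `w`, the scaled Hermite means `√n * hermiteMean z n l`,
the Hermite means `a`, and the reciprocal `b` of the sample variance. -/
noncomputable def jbPoly (w a : ℕ → ℝ) (b : ℝ) : ℝ :=
  ((w 3 - 3 * w 1 * a 2 + 2 * w 1 * a 1 ^ 2) ^ 2 * b ^ 3 +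
    (w 4 - 3 * w 2 * a 2 - 4 * w 1 * a 3 + 12 * w 1 * a 1 * a 2 - 6 * w 1 * a 1 ^ 3) ^ 2 *
      b ^ 4 / 4) / 6

/-- The prefactor `n` is `√n` squared; inside each square, every monomial gives its `√n` to exactly
one Hermite mean. -/
lemma jbStat_eq_jbPoly (z : ℕ → ℝ) {n : ℕ} (hz : sampleCentralMoment z n 2 ≠ 0) :
    jbStat z n = jbPoly (fun l => √(n : ℝ) * hermiteMean z n l) (hermiteMean z n)
      (sampleCentralMoment z n 2)⁻¹ := by
  have hn : n ≠ 0 := by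
    rintro rfl
    simp [sampleCentralMoment] at hz
  have h4 : sampleCentralMoment z n 4 / sampleCentralMoment z n 2 ^ 2 - 3 =
      (sampleCentralMoment z n 4 - 3 * sampleCentralMoment z n 2 ^ 2) *
        (sampleCentralMoment z n 2)⁻¹ ^ 2 := by
    field_simp
  have hs : (n : ℝ) = √(n : ℝ) ^ 2 := (Real.sq_sqrt n.cast_nonneg).symm
  rw [jbStat_eq, h4, sampleCentralMoment_three_eq z hn, sampleCentralMoment_four_sub_eq z hn,
    jbPoly, div_eq_mul_inv (_ ^ 2) (_ ^ 3), ← inv_pow]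
  nth_rw 1 [hs]
  ring

/-! ### Theoretical quantities of a normal law -/

lemma map_affine_gaussianReal (m : ℝ) (v : NNReal) :
    (gaussianReal 0 1).map (fun z => m + √(v : ℝ) * z) = gaussianReal m v := by
  have h : (fun z : ℝ => m + √(v : ℝ) * z) = (m + ·) ∘ (√(v : ℝ) * ·) := rfl
  rw [h, ← Measure.map_map (by fun_prop) (by fun_prop), gaussianReal_map_const_mul,
    gaussianReal_map_const_add]
  congr 1
  · simp
  · ext
    simp

lemma hasLaw_standardize (m : ℝ) {v : NNReal} (hv : v ≠ 0) :
    HasLaw (fun x : ℝ => (x - m) / √(v : ℝ)) (gaussianReal 0 1) (gaussianReal m v) where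
  map_eq := by
    have hs : √(v : ℝ) ≠ 0 := by positivity
    rw [← map_affine_gaussianReal m v, Measure.map_map (by fun_prop) (by fun_prop)]
    convert! Measure.map_id using 2
    ext z
    simp [hs]

lemma sd_gaussianReal (m : ℝ) (v : NNReal) : sd (gaussianReal m v) = √(v : ℝ) := by
  rw [sd, variance_id_gaussianReal]

lemma integral_gaussianReal_eq_integral_standard (m : ℝ) (v : NNReal) {f : ℝ → ℝ}
    (hf : Measurable f) :
    ∫ x, f x ∂gaussianReal m v = ∫ z, f (m + √(v : ℝ) * z) ∂gaussianReal 0 1 := by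
  rw [← map_affine_gaussianReal m v, integral_map (by fun_prop) (by fun_prop)]

/-- Expectation of a Hermite expansion of degree at most four. -/
lemma integral_hermite_expansion (a b c d e : ℝ) :
    ∫ z, (a * hermiteFun 4 z + b * hermiteFun 3 z + c * hermiteFun 2 z + d * hermiteFun 1 z + e)
      ∂gaussianReal 0 1 = e := by
  have h (l : ℕ) (r : ℝ) : Integrable (fun z => r * hermiteFun l z) (gaussianReal 0 1) :=
    (integrable_hermiteFun l).const_mul r
  rw [integral_add (by exact (((h 4 a).add (h 3 b)).add (h 2 c)).add (h 1 d))
      (integrable_const _), integral_add (by exact ((h 4 a).add (h 3 b)).add (h 2 c)) (h 1 d),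
    integral_add (by exact (h 4 a).add (h 3 b)) (h 2 c), integral_add (h 4 a) (h 3 b)]
  simp [integral_const_mul, integral_hermiteFun]

lemma measurable_linA (G : Measure ℝ) (l : ℕ) : Measurable (linA G l) := by
  unfold linA
  fun_prop

section Moments

variable (m : ℝ) (v : NNReal)

lemma moment_zero_gaussianReal : moment id 0 (gaussianReal m v) = 1 := by
  simp [moment]

lemma moment_one_gaussianReal : moment id 1 (gaussianReal m v) = m := by
  simp [moment]

lemma moment_two_gaussianReal : moment id 2 (gaussianReal m v) = m ^ 2 + v := by
  have hs := Real.sq_sqrt v.coe_nonneg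
  simp only [moment, Pi.pow_apply, id]
  rw [integral_gaussianReal_eq_integral_standard m v (by fun_prop),
    -- These are the Hermite coefficients of `(m + √v z) ^ 2`; the constant one is the expectation.
    ← integral_hermite_expansion 0 0 v (2 * m * √(v : ℝ)) (m ^ 2 + v)]
  congr 1 with z
  rw [hermiteFun_one, hermiteFun_two]
  linear_combination z ^ 2 * hs

lemma moment_three_gaussianReal :
    moment id 3 (gaussianReal m v) = m ^ 3 + 3 * m * v := by
  have hs := Real.sq_sqrt v.coe_nonneg
  simp only [moment, Pi.pow_apply, id]
  rw [integral_gaussianReal_eq_integral_standard m v (by fun_prop),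
    ← integral_hermite_expansion 0 (v * √(v : ℝ)) (3 * m * v)
      (3 * m ^ 2 * √(v : ℝ) + 3 * v * √(v : ℝ)) (m ^ 3 + 3 * m * v)]
  congr 1 with z
  rw [hermiteFun_one, hermiteFun_two, hermiteFun_three]
  linear_combination (3 * m * z ^ 2 + √(v : ℝ) * z ^ 3) * hs

lemma centralMoment_gaussianReal (k : ℕ) : centralMoment id k (gaussianReal m v) =
    ∫ z, (√(v : ℝ) * z) ^ k ∂gaussianReal 0 1 := by
  simp only [centralMoment, Pi.pow_apply, Pi.sub_apply, id, integral_id_gaussianReal]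
  rw [integral_gaussianReal_eq_integral_standard m v (by fun_prop)]
  simp

lemma centralMoment_three_gaussianReal : centralMoment id 3 (gaussianReal m v) = 0 := by
  rw [centralMoment_gaussianReal]
  refine Eq.trans ?_ (integral_hermite_expansion 0 (√(v : ℝ) ^ 3) 0 (3 * √(v : ℝ) ^ 3) 0)
  congr 1 with z
  rw [hermiteFun_one, hermiteFun_three]
  ring

lemma centralMoment_four_gaussianReal :
    centralMoment id 4 (gaussianReal m v) = 3 * √(v : ℝ) ^ 4 := by
  rw [centralMoment_gaussianReal, ← integral_hermite_expansion (√(v : ℝ) ^ 4) 0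
    (6 * √(v : ℝ) ^ 4) 0 (3 * √(v : ℝ) ^ 4)]
  congr 1 with z
  rw [hermiteFun_two, hermiteFun_four]
  ring

lemma linA_two_gaussianReal (x : ℝ) : linA (gaussianReal m v) 2 x = (x - m) ^ 2 := by
  simp [linA, Finset.sum_range_succ, moment_one_gaussianReal, moment_zero_gaussianReal]
  ring

/-- Estimating the mean contributes `-l μ_{l-1} x` to `A(l)`. This is `-3 v x` here and vanishes for
`l = 2, 4`, where `μ_{l-1}` is an odd central moment. -/
lemma linA_three_gaussianReal (x : ℝ) :
    linA (gaussianReal m v) 3 x = (x - m) ^ 3 - 3 * v * x := by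
  simp [linA, Finset.sum_range_succ, moment_one_gaussianReal, moment_zero_gaussianReal,
    moment_two_gaussianReal, Nat.choose]
  ring

lemma linA_four_gaussianReal (x : ℝ) : linA (gaussianReal m v) 4 x = (x - m) ^ 4 := by
  simp [linA, Finset.sum_range_succ, moment_one_gaussianReal, moment_zero_gaussianReal,
    moment_two_gaussianReal, moment_three_gaussianReal, Nat.choose]
  ring

lemma isSymmetricAbout_gaussianReal : IsSymmetricAbout (gaussianReal m v) m := by
  rw [IsSymmetricAbout, gaussianReal_map_const_sub]
  congr 1
  ring

lemma variance_gaussianReal_eq_variance_standard {f : ℝ → ℝ} (hf : Measurable f) :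
    variance f (gaussianReal m v) =
      variance (fun z => f (m + √(v : ℝ) * z)) (gaussianReal 0 1) := by
  rw [← map_affine_gaussianReal m v, variance_map hf.aemeasurable (by fun_prop)]
  rfl

lemma bCoef_two_gaussianReal : bCoef (gaussianReal m v) 2 = 0 := by
  simp [bCoef, centralMoment_three_gaussianReal]

variable {v} (hv : v ≠ 0)
include hv

lemma aCoef_two_gaussianReal : aCoef (gaussianReal m v) 2 = 3 := by
  have hs : √(v : ℝ) ≠ 0 := by positivity
  simp only [aCoef, Nat.reduceMul, centralMoment_four_gaussianReal, sd_gaussianReal]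
  field_simp

lemma bj_two_gaussianReal : bj (gaussianReal m v) 2 = 6 := by
  have hs : √(v : ℝ) ≠ 0 := by positivity
  have hv2 := Real.sq_sqrt v.coe_nonneg
  have hmeas : Measurable (linB (gaussianReal m v) 2) := by
    have := measurable_linA (gaussianReal m v)
    unfold linB
    fun_prop
  have h (z : ℝ) : linB (gaussianReal m v) 2 (m + √(v : ℝ) * z) =
      hermiteFun 3 z - 3 * m / √(v : ℝ) := by
    simp only [linB, Nat.reduceMul, Nat.add_one_sub_one, linA_three_gaussianReal,
      centralMoment_three_gaussianReal, sd_gaussianReal, hermiteFun_three]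
    field_simp
    linear_combination 6 * √(v : ℝ) ^ 2 * (m + √(v : ℝ) * z) * hv2
  rw [bj, variance_gaussianReal_eq_variance_standard m v hmeas]
  simp only [h]
  rw [variance_sub_const (by fun_prop), variance_hermiteFun (by norm_num)]
  norm_num [Nat.factorial]

lemma aj_two_gaussianReal : aj (gaussianReal m v) 2 = 24 := by
  have hs : √(v : ℝ) ≠ 0 := by positivity
  have hmeas : Measurable (linC (gaussianReal m v) 2) := by
    have := measurable_linA (gaussianReal m v)
    unfold linC
    fun_prop
  have h (z : ℝ) : linC (gaussianReal m v) 2 (m + √(v : ℝ) * z) = hermiteFun 4 z - 3 := by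
    simp only [linC, Nat.reduceMul, linA_four_gaussianReal, linA_two_gaussianReal,
      centralMoment_four_gaussianReal, sd_gaussianReal, hermiteFun_four]
    field_simp
    ring
  rw [aj, variance_gaussianReal_eq_variance_standard m v hmeas]
  simp only [h]
  rw [variance_sub_const (by fun_prop), variance_hermiteFun (by norm_num)]
  norm_num [Nat.factorial]

lemma symStat_two_gaussianReal (x : ℕ → ℝ) (n : ℕ) :
    symStat (gaussianReal m v) x n 2 = jbStat x n := by
  rw [symStat, bj_two_gaussianReal m hv, aj_two_gaussianReal m hv, aCoef_two_gaussianReal m hv,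
    jbStat]
  ring

end Moments

/-! ### Convergence to the chi-square law -/

lemma tendstoInDistribution_id_of_hasLaw {ι E Ω' : Type*} {Ω : ι → Type*}
    {mΩ : ∀ i, MeasurableSpace (Ω i)} [MeasurableSpace Ω'] [TopologicalSpace E]
    [MeasurableSpace E] [OpensMeasurableSpace E] {μ : ∀ i, Measure (Ω i)}
    [∀ i, IsProbabilityMeasure (μ i)] {μ' : Measure Ω'} [IsProbabilityMeasure μ'] {ν : Measure E}
    [IsProbabilityMeasure ν] {X : ∀ i, Ω i → E} {l : Filter ι} {Z : Ω' → E}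
    (h : TendstoInDistribution X l Z μ μ') (hZ : HasLaw Z ν μ') :
    TendstoInDistribution X l id μ ν where
  forall_aemeasurable := h.forall_aemeasurable
  tendsto := by
    convert! h.tendsto using 2
    simp [hZ.map_eq]

/-- Distinct coordinates of a standard Gaussian vector are independent standard normals, so their
joint law is the product measure defining `chiSquare k`. -/
lemma hasLaw_sum_sq_chiSquare {ι : Type*} [Fintype ι] {k : ℕ} {e : Fin k → ι}
    (he : e.Injective) :
    HasLaw (fun y : EuclideanSpace ℝ ι => ∑ i, y (e i) ^ 2) (chiSquare k)
      (stdGaussian (EuclideanSpace ℝ ι)) where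
  map_eq := by
    have hind : iIndepFun (fun (i : ι) (z : ι → ℝ) => z i)
        (Measure.pi fun _ : ι => gaussianReal 0 1) :=
      iIndepFun_pi (X := fun _ => id) fun _ => aemeasurable_id
    have hmap := (iIndepFun_iff_map_fun_eq_pi_map
      (fun i => (measurable_pi_apply (e i)).aemeasurable)).1 (hind.precomp he)
    simp only [(measurePreserving_eval (fun _ : ι => gaussianReal 0 1) _).map_eq] at hmap
    rw [chiSquare, ← hmap, ← map_pi_eq_stdGaussian, Measure.map_map (by fun_prop) (by fun_prop),
      Measure.map_map (by fun_prop) (by fun_prop)]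
    rfl

section StandardNormal

variable {Ω : Type*} [MeasurableSpace Ω] {P : Measure Ω} {Z : ℕ → Ω → ℝ}

lemma aemeasurable_hermiteMean (hZ : ∀ i, AEMeasurable (Z i) P) (n l : ℕ) :
    AEMeasurable (fun ω => hermiteMean (fun i => Z i ω) n l) P := by
  unfold hermiteMean
  fun_prop

lemma aemeasurable_sampleCentralMoment (hZ : ∀ i, AEMeasurable (Z i) P) (n l : ℕ) :
    AEMeasurable (fun ω => sampleCentralMoment (fun i => Z i ω) n l) P := by
  unfold sampleCentralMoment sampleMean
  fun_prop

lemma aemeasurable_jbStat (hZ : ∀ i, AEMeasurable (Z i) P) (n : ℕ) :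
    AEMeasurable (fun ω => jbStat (fun i => Z i ω) n) P := by
  have h := aemeasurable_sampleCentralMoment hZ n
  simp only [jbStat_eq]
  exact (((((h 3).pow_const 2).div ((h 2).pow_const 3)).add
    (((((h 4).div ((h 2).pow_const 2)).sub_const 3).pow_const 2).div_const 4)).const_mul _)

variable (hlaw : ∀ i, HasLaw (Z i) (gaussianReal 0 1) P)
  (hindep : iIndepFun Z P)
include hlaw hindep

lemma tendsto_hermiteMean_ae {l : ℕ} (hl : l ≠ 0) :
    ∀ᵐ ω ∂P, Tendsto (fun n => hermiteMean (fun i => Z i ω) n l) atTop (𝓝 0) := by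
  have hint : Integrable (fun ω => hermiteFun l (Z 0 ω)) P := by
    have := integrable_hermiteFun l
    rw [← (hlaw 0).map_eq] at this
    exact this.comp_aemeasurable (hlaw 0).aemeasurable
  have h := strong_law_ae_real (fun i ω => hermiteFun l (Z i ω)) hint
    (fun i j hij => (hindep.indepFun hij).comp (measurable_hermiteFun l) (measurable_hermiteFun l))
    (fun i => ((hlaw i).identDistrib (hlaw 0)).comp (u := hermiteFun l) (by fun_prop))
  have h0 : ∫ ω, hermiteFun l (Z 0 ω) ∂P = 0 := by
    refine ((hlaw 0).integral_comp (f := hermiteFun l) (by fun_prop)).trans ?_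
    rw [integral_hermiteFun, if_neg hl]
  filter_upwards [h] with ω hω
  rw [h0] at hω
  refine hω.congr fun n => ?_
  rw [hermiteMean]
  ring

lemma tendsto_sampleCentralMoment_two_ae :
    ∀ᵐ ω ∂P, Tendsto (fun n => sampleCentralMoment (fun i => Z i ω) n 2) atTop (𝓝 1) := by
  filter_upwards [tendsto_hermiteMean_ae hlaw hindep one_ne_zero,
    tendsto_hermiteMean_ae hlaw hindep two_ne_zero] with ω h1 h2
  have h := (h2.add_const 1).sub (h1.pow 2)
  simp only [zero_add, ne_eq, OfNat.ofNat_ne_zero, not_false_eq_true, zero_pow, sub_zero] at h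
  refine h.congr' ?_
  filter_upwards [eventually_ne_atTop 0] with n hn
  rw [sampleCentralMoment_two_eq _ hn]

variable [IsProbabilityMeasure P]

/-- The scaled means of the Hermite polynomials of positive degree are asymptotically independent
and normal. -/
lemma tendstoInDistribution_sqrt_mul_hermiteMean (d : ℕ) :
    TendstoInDistribution (fun (n : ℕ) ω => WithLp.toLp 2 fun l : Fin d =>
      -- Coordinate `l` carries degree `l + 1`, since degree 0 is not centered.
      √(n : ℝ) * hermiteMean (fun i => Z i ω) n (l + 1) / √((l + 1 : ℕ).factorial : ℝ)) atTop
      (id : EuclideanSpace ℝ (Fin d) → _) (fun _ => P) (stdGaussian _) := by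
  have h := tendstoInDistribution_inv_sqrt_mul_sum_orthonormal (P := P) (ι := Fin d)
    (f := fun l x => hermiteFun (l + 1) x / √((l + 1 : ℕ).factorial : ℝ)) HasLaw.id hindep hlaw
    (fun l => by fun_prop) (fun l => by
      simpa only [div_eq_inv_mul] using (memLp_hermiteFun (l + 1)).const_mul _)
    (fun l => by rw [integral_div, integral_hermiteFun]; simp)
    (fun l k => by
      simp only [div_mul_div_comm]
      rw [integral_div, integral_hermiteFun_mul_hermiteFun]
      rcases eq_or_ne l k with rfl | hlk
      · rw [if_pos rfl, if_pos rfl, Real.mul_self_sqrt (by positivity), div_self (by positivity)]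
      · rw [if_neg (by simpa [Fin.ext_iff] using hlk), if_neg hlk, zero_div])
  have hfun : (fun (n : ℕ) ω => WithLp.toLp 2 fun l : Fin d =>
      √(n : ℝ) * hermiteMean (fun i => Z i ω) n (l + 1) / √((l + 1 : ℕ).factorial : ℝ)) =
      fun (n : ℕ) ω => WithLp.toLp 2 fun l : Fin d => (√(n : ℝ))⁻¹ * ∑ k ∈ Finset.range n,
        hermiteFun (l + 1) (Z k ω) / √((l + 1 : ℕ).factorial : ℝ) := by
    ext n ω l
    simp only [hermiteMean, ← Finset.sum_div]
    rcases eq_or_ne n 0 with rfl | hn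
    · simp
    · have hs := Real.sq_sqrt (n.cast_nonneg (α := ℝ))
      have : √(n : ℝ) ≠ 0 := by positivity
      nth_rw 2 [← hs]
      field_simp
  rwa [hfun]

theorem tendstoInDistribution_jbStat_standard :
    TendstoInDistribution (fun (n : ℕ) ω => jbStat (fun i => Z i ω) n) atTop (id : ℝ → ℝ)
      (fun _ => P) (chiSquare 2) := by
  have hZ (i : ℕ) := (hlaw i).aemeasurable
  -- The quantities with constant limits, for Slutsky's theorem.
  let A : ℕ → Ω → (Fin 4 → ℝ) × ℝ := fun n ω =>
    (fun l => hermiteMean (fun i => Z i ω) n (l + 1), (sampleCentralMoment (fun i => Z i ω) n 2)⁻¹)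
  have hA (n : ℕ) : AEMeasurable (A n) P :=
    AEMeasurable.prodMk (aemeasurable_pi_lambda _ fun l => aemeasurable_hermiteMean hZ n (l + 1))
      (aemeasurable_sampleCentralMoment hZ n 2).inv
  have hA_tendsto : TendstoInMeasure P A atTop fun _ => ((0 : Fin 4 → ℝ), (1 : ℝ)) := by
    refine tendstoInMeasure_of_tendsto_ae (fun n => (hA n).aestronglyMeasurable) ?_
    filter_upwards [ae_all_iff.2 fun l => tendsto_hermiteMean_ae hlaw hindep (Nat.succ_ne_zero l),
      tendsto_sampleCentralMoment_two_ae hlaw hindep] with ω h1 h2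
    refine Tendsto.prodMk_nhds (tendsto_pi_nhds.2 fun l => h1 l) ?_
    simpa using h2.inv₀ one_ne_zero
  -- Degree `l` sits at index `l - 1`, and `√(l!)` undoes the normalization of the limit theorem.
  let g : EuclideanSpace ℝ (Fin 4) × ((Fin 4 → ℝ) × ℝ) → ℝ := fun q =>
    jbPoly (fun l => √(l.factorial : ℝ) * q.1 (Fin.ofNat 4 (l - 1)))
      (fun l => q.2.1 (Fin.ofNat 4 (l - 1))) q.2.2
  have hg : Continuous g := by
    unfold g jbPoly
    fun_prop
  have hlim := (tendstoInDistribution_sqrt_mul_hermiteMean hlaw hindep 4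
    ).continuous_comp_prodMk_of_tendstoInMeasure_const hg hA_tendsto hA
  have hchi : HasLaw (fun y : EuclideanSpace ℝ (Fin 4) => g (id y, (0, 1))) (chiSquare 2)
      (stdGaussian (EuclideanSpace ℝ (Fin 4))) := by
    -- At the limit `(0, 1)` only degrees 3 and 4 remain: `(3! y₂² + 4! y₃² / 4) / 6 = y₂² + y₃²`.
    convert! hasLaw_sum_sq_chiSquare (e := ![(2 : Fin 4), 3]) (by decide) using 2 with y
    simp [g, jbPoly, mul_pow, Nat.factorial]
    ring
  refine tendstoInDistribution_of_tendstoInMeasure_sub _ _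
    (tendstoInDistribution_id_of_hasLaw hlim hchi) ?_ (aemeasurable_jbStat hZ)
  refine tendstoInMeasure_of_tendsto_ae (fun n => ((aemeasurable_jbStat hZ n).sub
    (hlim.forall_aemeasurable n)).aestronglyMeasurable) ?_
  filter_upwards [tendsto_sampleCentralMoment_two_ae hlaw hindep] with ω hω
  refine tendsto_const_nhds.congr' ?_
  -- The polynomial form needs a nonzero sample variance, which holds almost surely for all large
  -- `n`; from then on the difference is exactly 0.
  filter_upwards [hω.eventually_ne one_ne_zero] with n hn
  have hfac (l : ℕ) : √(l.factorial : ℝ) ≠ 0 := by positivity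
  simp only [Pi.sub_apply, Pi.zero_apply, jbStat_eq_jbPoly _ hn]
  simp [g, A, jbPoly, mul_div_cancel₀ _ (hfac _), mul_div_cancel₀ _ (show √(2 : ℝ) ≠ 0 by simp)]

end StandardNormal

end JarqueBera

theorem mainTheorem4 {Ω : Type*} [MeasurableSpace Ω] (P : Measure Ω) [IsProbabilityMeasure P]
    (X : ℕ → Ω → ℝ) (G : Measure ℝ) (m : ℝ) (v : NNReal) (hv : v ≠ 0)
    (hG : G = gaussianReal m v)
    (hlaw : ∀ i, HasLaw (X i) G P) (hindep : iIndepFun X P) :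
    TendstoInDistribution (fun (n : ℕ) (ω : Ω) => JarqueBera.jbStat (fun i => X i ω) n)
        atTop (id : ℝ → ℝ) (fun _ => P) (JarqueBera.chiSquare 2) ∧
      (JarqueBera.IsSymmetricAbout G m ∧ Integrable (fun x : ℝ => x ^ (4 * 2)) G) ∧
      (JarqueBera.bCoef G 2 = 0 ∧ JarqueBera.aCoef G 2 = 3) ∧
      (JarqueBera.bj G 2 = 6 ∧ JarqueBera.aj G 2 = 24) ∧
      ∀ (x : ℕ → ℝ) (n : ℕ), JarqueBera.symStat G x n 2 = JarqueBera.jbStat x n := by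
  subst hG
  refine ⟨?_, ⟨JarqueBera.isSymmetricAbout_gaussianReal m v, ?_⟩,
    ⟨JarqueBera.bCoef_two_gaussianReal m v, JarqueBera.aCoef_two_gaussianReal m hv⟩,
    ⟨JarqueBera.bj_two_gaussianReal m hv, JarqueBera.aj_two_gaussianReal m hv⟩,
    JarqueBera.symStat_two_gaussianReal m hv⟩
  · have hs : √(v : ℝ) ≠ 0 := by positivity
    have h := JarqueBera.tendstoInDistribution_jbStat_standard
      (fun i => (JarqueBera.hasLaw_standardize m hv).fun_comp (hlaw i)) (hindep.comp (fun _ x => (x - m) / √(v : ℝ))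
        fun _ => by fun_prop)
    convert! h using 3 with n ω
    rw [← JarqueBera.jbStat_affine hs m fun i => (X i ω - m) / √(v : ℝ)]
    simp only [mul_div_cancel₀ _ hs, add_sub_cancel]
  · exact (JarqueBera.integrable_eval_gaussianReal m v (Polynomial.X ^ (4 * 2))).congr
      (ae_of_all _ fun x => by simp only [Polynomial.eval_pow, Polynomial.eval_X])
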